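/- Let $n\ge 1$, let $\Omega\subset\mathbb R^n$ be a nonempty, bounded, open set and let $1<p<\infty$. Suppose that $f=f(x,s):\Omega\times\mathbb R\to\mathbb R$ is continuous in $\Omega\times\mathbb R$ and non-increasing in $s$. If $u\in W^{1,p}_{loc}(\Omega)\cap C(\Omega)$ is a weak supersolution of $$-\Delta_p u:=-\mathrm{div}\big(|\nabla u|^{p-2}\nabla u\big)=f(x,u)\quad\text{in }\Omega,$$ that is, $$\int_\Omega|\nabla u|^{p-2}\nabla u\cdot\nabla\psi\,dx\ \ge\ \int_\Omega f(x,u)\,\psi\,dx\qquad\text{for all }\psi\in C_0^\infty(\Omega),\ \psi\ge 0,$$ then $u$ is a viscosity supersolution of the same equation in $\Omega$. Here a lower semicontinuous function $u:\Omega\to(-\infty,+\infty]$ is called a viscosity supersolution if $u\not\equiv+\infty$ and, for every $x_0\in\Omega$ and every $\varphi\in C^2(\Omega)$ such that $\varphi(x_0)=u(x_0)$ and, for all $x\in\Omega\setminus\{x_0\}$, $u(x)\ge\varphi(x)$ and $\nabla\varphi(x)\ne 0$, one has $$\lim_{r\to0}\ \sup_{x\in B_r(x_0)\setminus\{x_0\}}\big(-\Delta_p\varphi(x)\big)\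 \ge\ f(x_0,u(x_0)).$$ -/

import Mathlib

open MeasureTheory Filter Topology TopologicalSpace
open scoped Distributions RealInnerProductSpace

noncomputable section

/-- `ℝⁿ` with its Euclidean norm. -/
abbrev Rn (n : ℕ) : Type := EuclideanSpace ℝ (Fin n)

/-- The vector `|η|^(p-2) η`. For `p > 1` its value at `η = 0` is `0`, whatever the
convention for the power of `0`. -/
def pFlux {n : ℕ} (p : ℝ) (η : Rn n) : Rn n := ‖η‖ ^ (p - 2) • η

/-- The divergence `∑ᵢ ∂ᵢ Vᵢ (x)` of a vector field that is differentiable at `x`. -/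
def divergence {n : ℕ} (V : Rn n → Rn n) (x : Rn n) : ℝ :=
  ∑ i : Fin n, (fderiv ℝ V x (EuclideanSpace.single i 1)) i

/-- The pointwise `p`-Laplacian `Δ_p φ (x) = div (|∇φ|^(p-2) ∇φ) (x)`. It is meaningful for `φ` of
class `C²` near a point `x` with `∇φ(x) ≠ 0`; it is used only at such points. -/
def pLaplacian {n : ℕ} (p : ℝ) (φ : Rn n → ℝ) (x : Rn n) : ℝ :=
  divergence (fun y => pFlux p (gradient φ y)) x

/-- `g ∈ L^p_loc(Ω)`: `g` is in `L^p` of every compact subset of `Ω`. -/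
def MemLpLoc {n : ℕ} {F : Type*} [NormedAddCommGroup F] (p : ℝ) (Ω : Opens (Rn n))
    (g : Rn n → F) : Prop :=
  ∀ K : Set (Rn n), IsCompact K → K ⊆ (Ω : Set (Rn n)) →
    MemLp g (ENNReal.ofReal p) (volume.restrict K)

/-- `u ∈ W^{1,p}_loc(Ω)` with weak gradient `G`: both are in `L^p_loc(Ω)`, and
`∫_Ω u ∇ψ = - ∫_Ω ψ G` for every `ψ ∈ C₀^∞(Ω)`. The weak gradient is unique up to
null subsets of `Ω`. -/
structure HasW1pLocGradient {n : ℕ} (p : ℝ) (Ω : Opens (Rn n)) (u : Rn n → ℝ)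
    (G : Rn n → Rn n) : Prop where
  memLpLoc : MemLpLoc p Ω u
  memLpLoc_grad : MemLpLoc p Ω G
  integral_eq : ∀ ψ : 𝓓(Ω, ℝ),
    ∫ x in (Ω : Set (Rn n)), u x • gradient ψ x = - ∫ x in (Ω : Set (Rn n)), ψ x • G x

/-- `u ∈ W^{1,p}_loc(Ω)` is a weak supersolution of `-Δ_p u = f(x, u, ∇u)` in `Ω`:
`∫_Ω |∇u|^(p-2) ∇u · ∇ψ ≥ ∫_Ω f(x, u, ∇u) ψ` for all nonnegative `ψ ∈ C₀^∞(Ω)`, where the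
right-hand integrand is integrable (the left-hand one always is, as `∇u ∈ L^p_loc`). -/
def IsWeakSupersolution {n : ℕ} (p : ℝ) (Ω : Opens (Rn n)) (f : Rn n → ℝ → Rn n → ℝ)
    (u : Rn n → ℝ) : Prop :=
  ∃ G : Rn n → Rn n, HasW1pLocGradient p Ω u G ∧
    ∀ ψ : 𝓓(Ω, ℝ), (∀ x, 0 ≤ ψ x) →
      IntegrableOn (fun x => f x (u x) (G x) * ψ x) (Ω : Set (Rn n)) ∧
      ∫ x in (Ω : Set (Rn n)), f x (u x) (G x) * ψ x ≤
        ∫ x in (Ω : Set (Rn n)), ⟪pFlux p (G x), gradient ψ x⟫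

/-- `u : Ω → (-∞, +∞]` is a viscosity supersolution of `-Δ_p u = f(x, u, ∇u)` in `Ω`. The
limit as `r → 0` of the supremum over `B_r(x₀) \ {x₀}` is the `limsup` along the punctured
neighbourhoods of `x₀`, taken in the extended reals. -/
structure IsViscositySupersolution {n : ℕ} (p : ℝ) (Ω : Opens (Rn n))
    (f : Rn n → ℝ → Rn n → ℝ) (u : Rn n → EReal) : Prop where
  lowerSemicontinuousOn : LowerSemicontinuousOn u (Ω : Set (Rn n))
  ne_bot : ∀ x ∈ Ω, u x ≠ ⊥
  not_identically_top : ∃ x ∈ Ω, u x ≠ ⊤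
  le_limsup : ∀ x₀ ∈ Ω, ∀ φ : Rn n → ℝ, ContDiffOn ℝ 2 φ (Ω : Set (Rn n)) →
    (φ x₀ : EReal) = u x₀ →
    (∀ x ∈ Ω, x ≠ x₀ → (φ x : EReal) ≤ u x ∧ gradient φ x ≠ 0) →
    (f x₀ (u x₀).toReal (gradient φ x₀) : EReal) ≤
      limsup (fun x => ((-pLaplacian p φ x : ℝ) : EReal)) (𝓝[≠] x₀)

end

open scoped Convolution

/-! The argument is by contradiction. If the limsup lies below `f x₀ (u x₀)`, continuity gives
constants `C < C'` and a ball in which `-Δ_p φ < C` off `x₀` and `f(x,u) > C'`. There `φ` is a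
strict classical subsolution touching `u` from below
(`HasW1pLocGradient.not_touching_of_neg_pLaplacian_lt`).

Assume first that the contact is strict. Put `v = φ - u`, let `G` be the weak gradient of `u`, and
let `H = |G|^(p-2) G - |∇φ|^(p-2) ∇φ`. Subtracting the two weak inequalities gives `∫ H·∇ψ ≥ (C' -
C) ∫ ψ` for test functions `ψ ≥ 0`. The natural choice is a truncation of `v` just below its peak at
`x₀`: monotonicity of the flux makes `H·∇v ≤ 0`, which is a contradiction. As only smooth `ψ` are
admissible, `v` is mollified; the error is small by continuity of translations in `L^p` and Hölder,
while `∫ ψ` stays bounded below (`HasWeakGradientOn.exists_testFunction`).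

Two points need care. `∇φ` may vanish at `x₀`, where the flux need not be differentiable; it is
continuous, so the point is removable in the weak inequality
(`integral_inner_gradient_le_of_neg_divergence_le`). If the contact is not strict, there is another
contact point `y`, with `∇φ(y) ≠ 0`; subtracting `|z - y|^4` makes contact at `y` strict and keeps
`Δ_p φ(y)`. -/

/-! ### Continuity and monotonicity of the flux -/

theorem norm_pFlux {n : ℕ} {p : ℝ} (hp : 1 < p) (η : Rn n) : ‖pFlux p η‖ = ‖η‖ ^ (p - 1) := by
  rcases eq_or_ne η 0 with rfl | h
  · simp [pFlux, Real.zero_rpow (by linarith : p - 1 ≠ 0)]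
  · have h' : 0 < ‖η‖ := norm_pos_iff.2 h
    rw [pFlux, norm_smul, Real.norm_of_nonneg (by positivity), ← Real.rpow_add_one h'.ne']
    ring_nf

theorem contDiffAt_pFlux {n : ℕ} (p : ℝ) {η : Rn n} (h : η ≠ 0) {k : WithTop ℕ∞} :
    ContDiffAt ℝ k (pFlux p) η :=
  ((contDiffAt_norm ℝ h).rpow_const_of_ne (norm_ne_zero_iff.2 h)).smul contDiffAt_id

theorem continuous_pFlux {n : ℕ} {p : ℝ} (hp : 1 < p) :
    Continuous (pFlux p : Rn n → Rn n) := by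
  rw [continuous_iff_continuousAt]
  intro η
  rcases eq_or_ne η 0 with rfl | h
  · have h0 : pFlux p (0 : Rn n) = 0 := by simp [pFlux]
    rw [ContinuousAt, h0, tendsto_zero_iff_norm_tendsto_zero]
    simp only [norm_pFlux hp]
    have : Continuous fun η : Rn n => ‖η‖ ^ (p - 1) :=
      continuous_norm.rpow_const fun _ => Or.inr (by linarith)
    simpa [Real.zero_rpow (by linarith : p - 1 ≠ 0)] using this.tendsto (0 : Rn n)
  · exact (contDiffAt_pFlux p h (k := 0)).continuousAt

/-- By Cauchy–Schwarz the pairing is at least `(|a|^(p-1) - |b|^(p-1)) (|a| - |b|)`, whose factors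
have the same sign. -/
theorem inner_pFlux_sub_nonneg {n : ℕ} {p : ℝ} (hp : 1 < p) (a b : Rn n) :
    0 ≤ ⟪pFlux p a - pFlux p b, a - b⟫ := by
  have key : ⟪pFlux p a - pFlux p b, a - b⟫ = ‖a‖ ^ (p - 2) * ‖a‖ ^ 2
      - (‖a‖ ^ (p - 2) + ‖b‖ ^ (p - 2)) * ⟪a, b⟫ + ‖b‖ ^ (p - 2) * ‖b‖ ^ 2 := by
    simp only [pFlux, inner_sub_left, inner_sub_right, real_inner_smul_left,
      real_inner_self_eq_norm_sq, real_inner_comm a b]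
    ring
  have e : ∀ c : Rn n, ‖c‖ ^ (p - 2) * ‖c‖ = ‖c‖ ^ (p - 1) := fun c => by
    rw [← norm_pFlux hp, pFlux, norm_smul, Real.norm_of_nonneg (by positivity)]
  have hm : 0 ≤ (‖a‖ ^ (p - 1) - ‖b‖ ^ (p - 1)) * (‖a‖ - ‖b‖) := by
    rcases le_total ‖a‖ ‖b‖ with h | h
    · have := Real.rpow_le_rpow (norm_nonneg a) h (by linarith : 0 ≤ p - 1)
      exact mul_nonneg_of_nonpos_of_nonpos (by linarith) (by linarith)
    · have := Real.rpow_le_rpow (norm_nonneg b) h (by linarith : 0 ≤ p - 1)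
      exact mul_nonneg (by linarith) (by linarith)
  have hi := mul_le_mul_of_nonneg_left (real_inner_le_norm a b)
    (by positivity : 0 ≤ ‖a‖ ^ (p - 2) + ‖b‖ ^ (p - 2))
  rw [← e, ← e] at hm
  rw [key]
  nlinarith

/-! ### Gradients and integration by parts -/

theorem inner_gradient_eq_fderiv {n : ℕ} (ψ : Rn n → ℝ) (x e : Rn n) :
    ⟪e, gradient ψ x⟫ = fderiv ℝ ψ x e := by
  rw [real_inner_comm, ← InnerProductSpace.toDual_apply_apply (𝕜 := ℝ), toDual_gradient]

theorem gradient_apply {n : ℕ} (ψ : Rn n → ℝ) (x : Rn n) (i : Fin n) :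
    gradient ψ x i = fderiv ℝ ψ x (EuclideanSpace.single i 1) := by
  rw [← inner_gradient_eq_fderiv, EuclideanSpace.inner_single_left]
  simp

theorem gradient_eq_toDual_symm {n : ℕ} (ψ : Rn n → ℝ) :
    gradient ψ = fun x => (InnerProductSpace.toDual ℝ (Rn n)).symm (fderiv ℝ ψ x) := rfl

theorem continuous_gradient {n : ℕ} {ψ : Rn n → ℝ} (h : ContDiff ℝ 1 ψ) :
    Continuous (gradient ψ) :=
  (InnerProductSpace.toDual ℝ (Rn n)).symm.continuous.comp (h.continuous_fderiv one_ne_zero)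

theorem contDiffOn_gradient {n : ℕ} {φ : Rn n → ℝ} {U : Set (Rn n)} (hU : IsOpen U)
    (h : ContDiffOn ℝ 2 φ U) : ContDiffOn ℝ 1 (gradient φ) U :=
  (InnerProductSpace.toDual ℝ (Rn n)).symm.toContinuousLinearEquiv.contDiff.comp_contDiffOn
    (h.fderiv_of_isOpen hU (by norm_num))

theorem tsupport_gradient_subset {n : ℕ} (ψ : Rn n → ℝ) :
    tsupport (gradient ψ) ⊆ tsupport ψ := by
  refine (closure_mono fun x hx => ?_).trans (tsupport_fderiv_subset ℝ (f := ψ))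
  contrapose! hx
  simp [gradient_eq_toDual_symm, Function.notMem_support.1 hx]

theorem ContinuousOn.integrable_smul_of_tsupport_subset {n : ℕ} {F : Type*}
    [NormedAddCommGroup F] [NormedSpace ℝ F] {U : Set (Rn n)} (hU : IsOpen U)
    {a : Rn n → F} (ha : ContinuousOn a U) {ψ : Rn n → ℝ} (hψ : Continuous ψ)
    (hc : HasCompactSupport ψ) (hs : tsupport ψ ⊆ U) :
    Continuous (fun x => ψ x • a x) ∧ Integrable (fun x => ψ x • a x) := by
  have h1 : Continuous (fun x => ψ x • a x) :=
    (hψ.continuousOn.smul ha).continuous_of_tsupport_subset hU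
      ((tsupport_smul_subset_left ψ a).trans hs)
  exact ⟨h1, h1.integrable_of_hasCompactSupport hc.smul_right⟩

theorem ContinuousOn.integrable_inner_gradient {n : ℕ} {U : Set (Rn n)} (hU : IsOpen U)
    {Φ : Rn n → Rn n} (hΦ : ContinuousOn Φ U) {ψ : Rn n → ℝ} (hψ : ContDiff ℝ 1 ψ)
    (hc : HasCompactSupport ψ) (hs : tsupport ψ ⊆ U) :
    Integrable (fun x => ⟪Φ x, gradient ψ x⟫) := by
  have hsupp : Function.support (fun x => ⟪Φ x, gradient ψ x⟫) ⊆ tsupport ψ := fun x hx => by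
    contrapose! hx
    have : x ∉ tsupport (gradient ψ) := fun h => hx (tsupport_gradient_subset ψ h)
    rw [Function.notMem_support, image_eq_zero_of_notMem_tsupport this, inner_zero_right]
  have h1 : Continuous (fun x => ⟪Φ x, gradient ψ x⟫) :=
    (hΦ.inner (continuous_gradient hψ).continuousOn).continuous_of_tsupport_subset hU
      ((closure_minimal hsupp (isClosed_tsupport ψ)).trans hs)
  exact h1.integrable_of_hasCompactSupport
    (HasCompactSupport.of_support_subset_isCompact hc hsupp)

theorem integral_mul_fderiv_of_contDiffOn {n : ℕ} {U : Set (Rn n)} (hU : IsOpen U)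
    {a : Rn n → ℝ} (ha : ContDiffOn ℝ 1 a U) {ψ : Rn n → ℝ} (hψ : ContDiff ℝ 1 ψ)
    (hc : HasCompactSupport ψ) (hs : tsupport ψ ⊆ U) (e : Rn n) :
    Integrable (fun x => a x * fderiv ℝ ψ x e) ∧ Integrable (fun x => fderiv ℝ a x e * ψ x) ∧
    ∫ x, a x * fderiv ℝ ψ x e = - ∫ x, fderiv ℝ a x e * ψ x := by
  have hψ' : Continuous fun x => fderiv ℝ ψ x e :=
    (hψ.continuous_fderiv one_ne_zero).clm_apply continuous_const
  have h1 : Integrable (fun x => a x * fderiv ℝ ψ x e) := by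
    have := (ha.continuousOn.integrable_smul_of_tsupport_subset hU hψ' (hc.fderiv_apply ℝ e)
      ((tsupport_fderiv_apply_subset ℝ e).trans hs)).2
    simpa [mul_comm] using this
  have h2 : Integrable (fun x => fderiv ℝ a x e * ψ x) := by
    have h : ContinuousOn (fun x => fderiv ℝ a x e) U :=
      (ha.continuousOn_fderiv_of_isOpen hU le_rfl).clm_apply continuousOn_const
    simpa [mul_comm] using (h.integrable_smul_of_tsupport_subset hU hψ.continuous hc hs).2
  refine ⟨h1, h2, integral_mul_fderiv_eq_neg_fderiv_mul_of_integrable h2 h1 ?_ ?_ ?_⟩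
  · simpa [mul_comm] using
      (ha.continuousOn.integrable_smul_of_tsupport_subset hU hψ.continuous hc hs).2
  · exact fun x hx => (ha.differentiableOn one_ne_zero).differentiableAt (hU.mem_nhds (hs hx))
  · exact fun x _ => hψ.differentiable one_ne_zero x

theorem integral_inner_gradient_eq_neg_integral_divergence {n : ℕ} {U : Set (Rn n)}
    (hU : IsOpen U) {Φ : Rn n → Rn n} (hΦ : ContDiffOn ℝ 1 Φ U) {ψ : Rn n → ℝ}
    (hψ : ContDiff ℝ 1 ψ) (hc : HasCompactSupport ψ) (hs : tsupport ψ ⊆ U) :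
    Integrable (fun x => divergence Φ x * ψ x) ∧
    ∫ x, ⟪Φ x, gradient ψ x⟫ = - ∫ x, divergence Φ x * ψ x := by
  have hi : ∀ i : Fin n, ContDiffOn ℝ 1 (fun x => Φ x i) U := fun i =>
    (contDiffOn_euclidean.1 hΦ) i
  have hd : ∀ i : Fin n, ∀ x, fderiv ℝ (fun y => Φ y i) x (EuclideanSpace.single i 1) * ψ x =
      (fderiv ℝ Φ x (EuclideanSpace.single i 1)) i * ψ x := by
    intro i x
    by_cases hx : x ∈ tsupport ψ
    · have := ((hΦ.differentiableOn one_ne_zero).differentiableAt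
        (hU.mem_nhds (hs hx))).hasFDerivAt
      have h2 : HasFDerivAt (fun y => Φ y i) _ x :=
        (EuclideanSpace.proj (𝕜 := ℝ) i).hasFDerivAt.comp x this
      rw [h2.fderiv]
      simp
    · simp [image_eq_zero_of_notMem_tsupport hx]
  have H := fun i : Fin n => integral_mul_fderiv_of_contDiffOn hU (hi i) hψ hc hs
    (EuclideanSpace.single i 1)
  simp only [divergence, Finset.sum_mul]
  simp only [hd] at H
  refine ⟨integrable_finsetSum _ fun i _ => (H i).2.1, ?_⟩
  rw [integral_finsetSum _ fun i _ => (H i).2.1, ← Finset.sum_neg_distrib]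
  simp only [← (H _).2.2]
  rw [← integral_finsetSum _ fun i _ => (H i).1]
  refine integral_congr_ae (Eventually.of_forall fun x => ?_)
  beta_reduce
  rw [PiLp.inner_apply]
  simp [gradient_apply, mul_comm]

theorem integral_inner_gradient_const_eq_zero {n : ℕ} {ψ : Rn n → ℝ} (hψ : ContDiff ℝ 1 ψ)
    (hc : HasCompactSupport ψ) (c : Rn n) : ∫ x, ⟪c, gradient ψ x⟫ = 0 := by
  have := (integral_inner_gradient_eq_neg_integral_divergence isOpen_univ
    (contDiffOn_const (c := c)) hψ hc (Set.subset_univ _)).2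
  simpa [divergence] using this

theorem norm_gradient {n : ℕ} (ψ : Rn n → ℝ) (x : Rn n) : ‖gradient ψ x‖ = ‖fderiv ℝ ψ x‖ := by
  rw [gradient_eq_toDual_symm, LinearIsometryEquiv.norm_map]

theorem gradient_mul {n : ℕ} {a b : Rn n → ℝ} {x : Rn n} (ha : DifferentiableAt ℝ a x)
    (hb : DifferentiableAt ℝ b x) :
    gradient (fun y => a y * b y) x = a x • gradient b x + b x • gradient a x := by
  simp [gradient_eq_toDual_symm, fderiv_fun_mul ha hb]

/-! ### Removing a point singularity from the weak inequality -/

/-- Smooth cutoffs near a point with the natural bound on their gradients. -/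
theorem exists_cutoff {n : ℕ} (x₀ : Rn n) : ∃ M : ℝ, ∃ η : ℕ → Rn n → ℝ, ∀ k : ℕ,
    ContDiff ℝ 1 (η k) ∧ (∀ x, 0 ≤ η k x) ∧ (∀ x, η k x ≤ 1) ∧ (η k =ᶠ[𝓝 x₀] 1) ∧
    (∀ x, ‖gradient (η k) x‖ ≤ M * (k + 1)) ∧
    (∀ x, 2 < (k + 1) * dist x x₀ → η k x = 0) ∧
    (∀ x, 2 < (k + 1) * dist x x₀ → gradient (η k) x = 0) := by
  let χ : ContDiffBump (0 : Rn n) := ⟨1, 2, by norm_num, by norm_num⟩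
  have hχ : ContDiff ℝ 1 χ := χ.contDiff
  obtain ⟨M, hM⟩ := (χ.hasCompactSupport.fderiv ℝ).exists_bound_of_continuous
    (hχ.continuous_fderiv one_ne_zero)
  have hd : ∀ k : ℕ, ∀ x : Rn n, HasFDerivAt (fun y : Rn n => ((k : ℝ) + 1) • (y - x₀))
      (((k : ℝ) + 1) • ContinuousLinearMap.id ℝ (Rn n)) x := fun k x =>
    ((hasFDerivAt_id x).sub_const x₀).fun_const_smul _
  have hf : ∀ k : ℕ, ∀ x : Rn n, fderiv ℝ (fun y => χ (((k : ℝ) + 1) • (y - x₀))) x =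
      ((k : ℝ) + 1) • fderiv ℝ χ (((k : ℝ) + 1) • (x - x₀)) := by
    intro k x
    have h1 : HasFDerivAt (fun y => χ (((k : ℝ) + 1) • (y - x₀))) _ x :=
      ((hχ.differentiable one_ne_zero _).hasFDerivAt).comp x (hd k x)
    rw [h1.fderiv]
    ext v
    simp
  have hz : ∀ k : ℕ, ∀ x : Rn n, 2 < (k + 1) * dist x x₀ →
      (((k : ℝ) + 1) • (x - x₀)) ∉ tsupport χ := by
    intro k x hx
    rw [χ.tsupport_eq, Metric.mem_closedBall, dist_zero_right, norm_smul, ← dist_eq_norm,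
      Real.norm_of_nonneg (by positivity), not_le]
    exact hx
  refine ⟨M, fun k x => χ (((k : ℝ) + 1) • (x - x₀)), fun k => ⟨?_, fun x => χ.nonneg,
    fun x => χ.le_one, ?_, fun x => ?_, fun x hx => ?_, fun x hx => ?_⟩⟩
  · exact hχ.comp ((contDiff_id.sub contDiff_const).const_smul _)
  · have h1 : Tendsto (fun y : Rn n => ((k : ℝ) + 1) • (y - x₀)) (𝓝 x₀) (𝓝 0) := by
      simpa using ((hd k x₀).continuousAt.tendsto)
    exact h1.eventually χ.eventuallyEq_one
  · rw [norm_gradient, hf, norm_smul, Real.norm_of_nonneg (by positivity), mul_comm]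
    exact mul_le_mul_of_nonneg_right (hM _) (by positivity)
  · exact image_eq_zero_of_notMem_tsupport (hz k x hx)
  · have h : fderiv ℝ χ (((k : ℝ) + 1) • (x - x₀)) = 0 :=
      image_eq_zero_of_notMem_tsupport fun h => hz k x hx (tsupport_fderiv_subset ℝ h)
    rw [← norm_eq_zero, norm_gradient, hf, h, smul_zero, norm_zero]

/-- The gradients are `O(k)` on a ball of volume `O(k^(-n))`, so the integral is `O(k^(1-n))` times
the supremum of `|Z|` there. For `n = 1` the decay comes only from `Z x₀ = 0`. -/
theorem tendsto_integral_inner_gradient_cutoff {n : ℕ} (hn : 1 ≤ n) {x₀ : Rn n} {M : ℝ}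
    {η : ℕ → Rn n → ℝ} (hM : ∀ k x, ‖gradient (η k) x‖ ≤ M * (k + 1))
    (h0 : ∀ (k : ℕ) x, 2 < (k + 1) * dist x x₀ → gradient (η k) x = 0)
    {Z : Rn n → Rn n} (hZ : Continuous Z) (hZ0 : Z x₀ = 0) :
    Tendsto (fun k => ∫ x, ⟪Z x, gradient (η k) x⟫) atTop (𝓝 0) := by
  have hM0 : 0 ≤ M := by simpa using (norm_nonneg _).trans (hM 0 x₀)
  set V := (volume : Measure (Rn n)).real (Metric.ball 0 1)
  rw [Metric.tendsto_atTop]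
  intro ε hε
  obtain ⟨δ, hδ, hδZ⟩ := Metric.continuousAt_iff.1 (hZ.continuousAt (x := x₀)) (ε / (2 * M * V + 1))
    (by positivity)
  obtain ⟨N, hN⟩ := exists_nat_gt (max 2 (2 / δ))
  refine ⟨N, fun k hk => ?_⟩
  have hk' : max 2 (2 / δ) < (k : ℝ) + 1 := hN.trans_le (by exact_mod_cast hk.trans k.le_succ)
  have hk2 : (2 : ℝ) < k + 1 := (le_max_left _ _).trans_lt hk'
  have hkδ : 2 / ((k : ℝ) + 1) < δ := by
    have := (le_max_right _ _).trans_lt hk'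
    rw [div_lt_iff₀ (by positivity)] at this ⊢
    linarith
  have hsub : ∫ x, ⟪Z x, gradient (η k) x⟫ =
      ∫ x in Metric.closedBall x₀ (2 / ((k : ℝ) + 1)), ⟪Z x, gradient (η k) x⟫ := by
    refine (setIntegral_eq_integral_of_forall_compl_eq_zero fun x hx => ?_).symm
    rw [Metric.mem_closedBall, not_le, div_lt_iff₀ (by positivity)] at hx
    rw [h0 k x (by linarith), inner_zero_right]
  have hb : ∀ x ∈ Metric.closedBall x₀ (2 / ((k : ℝ) + 1)), ‖⟪Z x, gradient (η k) x⟫‖ ≤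
      ε / (2 * M * V + 1) * (M * (k + 1)) := by
    intro x hx
    refine (norm_inner_le_norm _ _).trans (mul_le_mul ?_ (hM k x) (norm_nonneg _) (by positivity))
    have := hδZ (lt_of_le_of_lt (Metric.mem_closedBall.1 hx) hkδ)
    rw [hZ0, dist_zero_right] at this
    exact this.le
  rw [dist_zero_right, hsub]
  refine (norm_setIntegral_le_of_norm_le_const measure_closedBall_lt_top hb).trans_lt ?_
  -- As the radius is at most one, the estimate reduces to the worst case `n = 1`.
  have hr : (2 / ((k : ℝ) + 1)) ^ n ≤ 2 / ((k : ℝ) + 1) := by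
    refine pow_le_of_le_one (by positivity) ?_ (by omega)
    rw [div_le_one (by positivity)]
    exact hk2.le
  rw [Measure.addHaar_real_closedBall _ _ (by positivity), finrank_euclideanSpace, Fintype.card_fin]
  calc ε / (2 * M * V + 1) * (M * (k + 1)) * ((2 / ((k : ℝ) + 1)) ^ n * V)
      ≤ ε / (2 * M * V + 1) * (M * (k + 1)) * (2 / ((k : ℝ) + 1) * V) := by gcongr
    _ = ε * (2 * M * V / (2 * M * V + 1)) := by field_simp
    _ < ε * 1 := by
        gcongr
        rw [div_lt_one (by positivity)]
        linarith
    _ = ε := mul_one ε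

/-- A vector field that is continuous on `U` and of class `C¹` away from a single point satisfies
the weak form of any upper bound on `-div Φ` valid away from that point. -/
theorem integral_inner_gradient_le_of_neg_divergence_le {n : ℕ} (hn : 1 ≤ n) {U : Set (Rn n)}
    (hU : IsOpen U) {x₀ : Rn n}
    {Φ : Rn n → Rn n} (hΦc : ContinuousOn Φ U)
    (hΦ : ContDiffOn ℝ 1 Φ (U \ {x₀})) {C : ℝ} (hC : ∀ x ∈ U \ {x₀}, -divergence Φ x ≤ C)
    {ψ : Rn n → ℝ} (hψ : ContDiff ℝ 1 ψ) (hc : HasCompactSupport ψ) (hs : tsupport ψ ⊆ U)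
    (hψ0 : ∀ x, 0 ≤ ψ x) : ∫ x, ⟪Φ x, gradient ψ x⟫ ≤ C * ∫ x, ψ x := by
  obtain ⟨M, η, hη⟩ := exists_cutoff x₀
  choose hη1 hη0 hηle hηx hηM hηz hηg using hη
  have hU' : IsOpen (U \ {x₀}) := hU.sdiff isClosed_singleton
  -- Normalising the field to vanish at `x₀` is free: a constant field integrates to zero against
  -- `∇ψ`.
  set Ψ : Rn n → Rn n := fun x => Φ x - Φ x₀ with hΨ
  have hΨc : ContinuousOn Ψ U := hΦc.sub continuousOn_const
  have hΨ1 : ContDiffOn ℝ 1 Ψ (U \ {x₀}) := hΦ.sub contDiffOn_const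
  have hdiv : ∀ x, divergence Ψ x = divergence Φ x := fun x => by
    simp [divergence, hΨ, fderiv_sub_const]
  have hZ := hΨc.integrable_smul_of_tsupport_subset hU hψ.continuous hc hs
  have hinneri := hΨc.integrable_inner_gradient hU hψ hc hs
  have hψi : Integrable ψ := hψ.continuous.integrable_of_hasCompactSupport hc
  -- The test function `(1 - η k) ψ` is supported away from `x₀`, where the divergence theorem
  -- applies.
  have hstep : ∀ k, (∫ x, (1 - η k x) * ⟪Ψ x, gradient ψ x⟫) -
      ∫ x, ⟪ψ x • Ψ x, gradient (η k) x⟫ ≤ C * ∫ x, (1 - η k x) * ψ x := by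
    intro k
    have h1 : ContDiff ℝ 1 (fun x => (1 - η k x) * ψ x) := (contDiff_const.sub (hη1 k)).mul hψ
    have hc1 : HasCompactSupport (fun x => (1 - η k x) * ψ x) := hc.mul_left
    have hs1 : tsupport (fun x => (1 - η k x) * ψ x) ⊆ U \ {x₀} := by
      refine Set.subset_sdiff_singleton ((tsupport_mul_subset_right).trans hs) ?_
      rw [notMem_tsupport_iff_eventuallyEq]
      filter_upwards [hηx k] with x hx
      simp [hx]
    obtain ⟨hi, he⟩ := integral_inner_gradient_eq_neg_integral_divergence hU' hΨ1 h1 hc1 hs1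
    have hgr : ∀ x, ⟪Ψ x, gradient (fun x => (1 - η k x) * ψ x) x⟫ =
        (1 - η k x) * ⟪Ψ x, gradient ψ x⟫ - ⟪ψ x • Ψ x, gradient (η k) x⟫ := by
      intro x
      rw [gradient_mul (a := fun y => 1 - η k y)
        ((differentiableAt_const _).sub ((hη1 k).differentiable one_ne_zero x))
        (hψ.differentiable one_ne_zero x), inner_add_right, real_inner_smul_right,
        real_inner_smul_right, real_inner_smul_left, sub_eq_add_neg]
      have : gradient (fun y => 1 - η k y) x = - gradient (η k) x := by
        simp [gradient_eq_toDual_symm, fderiv_const_sub]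
      rw [this, inner_neg_right]
      ring
    have hi1 : Integrable (fun x => (1 - η k x) * ⟪Ψ x, gradient ψ x⟫) :=
      hinneri.bdd_mul (c := 1) (continuous_const.sub (hη1 k).continuous).aestronglyMeasurable
        (Eventually.of_forall fun x => by
          rw [Real.norm_of_nonneg (by linarith [hηle k x])]
          linarith [hη0 k x])
    have hi2 : Integrable (fun x => ⟪ψ x • Ψ x, gradient (η k) x⟫) :=
      (hZ.1.inner (continuous_gradient (hη1 k))).integrable_of_hasCompactSupport
        (HasCompactSupport.of_support_subset_isCompact hc fun x hx => by
          contrapose! hx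
          simp [image_eq_zero_of_notMem_tsupport hx])
    simp only [hgr] at he
    rw [integral_sub hi1 hi2] at he
    rw [he, ← integral_neg, ← integral_const_mul]
    refine integral_mono hi.neg ((h1.continuous.integrable_of_hasCompactSupport hc1).const_mul C)
      fun x => ?_
    have hnn : 0 ≤ (1 - η k x) * ψ x := mul_nonneg (by linarith [hηle k x]) (hψ0 x)
    by_cases hx : x ∈ U \ {x₀}
    · have := mul_le_mul_of_nonneg_right (hC x hx) hnn
      simp only [hdiv]
      linarith
    · have : (1 - η k x) * ψ x = 0 := by
        by_contra h
        exact hx (hs1 (subset_tsupport _ h))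
      simp [this]
  have hae : ∀ᵐ x ∂(volume : Measure (Rn n)), Tendsto (fun k => 1 - η k x) atTop (𝓝 1) := by
    -- Positive dimension is what makes the point `x₀` null.
    have : NeZero n := ⟨by omega⟩
    have : ∀ᵐ x ∂(volume : Measure (Rn n)), x ≠ x₀ := by simp [ae_iff]
    filter_upwards [this] with x hx
    refine tendsto_const_nhds.congr' ?_
    obtain ⟨N, hN⟩ := exists_nat_gt (2 / dist x x₀)
    filter_upwards [eventually_ge_atTop N] with k hk
    have hd : 0 < dist x x₀ := dist_pos.2 hx
    rw [hηz k x, sub_zero]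
    rw [div_lt_iff₀ hd] at hN
    have : (N : ℝ) ≤ k + 1 := by exact_mod_cast hk.trans k.le_succ
    nlinarith
  have hlim : ∀ g : Rn n → ℝ, Integrable g →
      Tendsto (fun k => ∫ x, (1 - η k x) * g x) atTop (𝓝 (∫ x, g x)) := by
    intro g hg
    refine tendsto_integral_of_dominated_convergence (fun x => ‖g x‖) (fun k => ?_) hg.norm
      (fun k => Eventually.of_forall fun x => ?_) ?_
    · exact (continuous_const.sub (hη1 k).continuous).aestronglyMeasurable.mul hg.1
    · rw [norm_mul, Real.norm_of_nonneg (by linarith [hηle k x])]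
      exact mul_le_of_le_one_left (norm_nonneg _) (by linarith [hη0 k x])
    · filter_upwards [hae] with x hx
      simpa using hx.mul_const (g x)
  have hfin := le_of_tendsto_of_tendsto'
    ((hlim _ hinneri).sub (tendsto_integral_inner_gradient_cutoff hn hηM hηg hZ.1 (by simp [hΨ])))
    ((hlim _ hψi).const_mul C) hstep
  have hconst := integral_inner_gradient_const_eq_zero hψ hc (Φ x₀)
  have hci := (continuousOn_const (c := Φ x₀)).integrable_inner_gradient hU hψ hc hs
  have : ∫ x, ⟪Φ x, gradient ψ x⟫ = (∫ x, ⟪Ψ x, gradient ψ x⟫) + ∫ x, ⟪Φ x₀, gradient ψ x⟫ := by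
    rw [← integral_add hinneri hci]
    refine integral_congr_ae (Eventually.of_forall fun x => ?_)
    beta_reduce
    rw [← inner_add_left]
    simp [hΨ]
  rw [this, hconst]
  linarith

/-! ### Mollification of weak gradients -/

/-- `D` is a weak gradient of `v` on `U`, tested on smooth functions supported in `U`. -/
def HasWeakGradientOn {n : ℕ} (U : Set (Rn n)) (v : Rn n → ℝ) (D : Rn n → Rn n) : Prop :=
  ∀ ψ : Rn n → ℝ, ContDiff ℝ ((⊤ : ℕ∞) : WithTop ℕ∞) ψ → HasCompactSupport ψ → tsupport ψ ⊆ U →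
    ∫ x, v x • gradient ψ x = - ∫ x, ψ x • D x

/-- Translations act continuously on `L^P` for finite `P`; `DomAddAct.mk (-z)` acts as `x ↦ x - z`
in the argument. -/
theorem tendsto_eLpNorm_translate_sub {n : ℕ} {F : Type*} [NormedAddCommGroup F] {P : ENNReal}
    (hP1 : 1 ≤ P) (hP : P ≠ ⊤) {D : Rn n → F} (hD : MemLp D P volume) :
    Tendsto (fun z => eLpNorm (fun x => D (x - z) - D x) P volume) (𝓝 0) (𝓝 0) := by
  have : Fact (1 ≤ P) := ⟨hP1⟩
  have : Fact (P ≠ ⊤) := ⟨hP⟩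
  have hc : Continuous fun z : Rn n => edist (DomAddAct.mk (-z) +ᵥ hD.toLp D) (hD.toLp D) := by
    have h : Continuous fun z : Rn n => DomAddAct.mk (-z) +ᵥ hD.toLp D :=
      continuous_vadd.comp
        ((DomAddAct.continuous_mk.comp continuous_neg).prodMk continuous_const)
    exact h.edist continuous_const
  have h0 := hc.tendsto 0
  have he : ∀ z : Rn n, edist (DomAddAct.mk (-z) +ᵥ hD.toLp D) (hD.toLp D) =
      eLpNorm (fun x => D (x - z) - D x) P volume := by
    intro z
    rw [DomAddAct.mk_vadd_toLp, Lp.edist_toLp_toLp]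
    congr 1
    ext x
    simp [sub_eq_neg_add]
  simp only [he] at h0
  simpa using h0

/-- The mollification error is an average, with weight of mass one, of the differences `D (x - z) -
D x`. Tonelli reduces the bound to Hölder for each fixed `z`. -/
theorem lintegral_enorm_mul_convolution_sub_le {n : ℕ} {F F' : Type*} [NormedAddCommGroup F]
    [NormedSpace ℝ F] [CompleteSpace F] [NormedAddCommGroup F'] {P Q : ENNReal} (hP1 : 1 ≤ P)
    [Q.HolderTriple P 1] (ρ : ContDiffBump (0 : Rn n)) {D : Rn n → F} (hD : MemLp D P volume)
    {H : Rn n → F'} (hH : AEStronglyMeasurable H volume) {δ : ENNReal}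
    (hδ : ∀ z ∈ Metric.ball (0 : Rn n) ρ.rOut,
      eLpNorm (fun x => D (x - z) - D x) P volume ≤ δ) :
    ∫⁻ x, ‖H x‖ₑ * ‖(ρ.normed volume ⋆[ContinuousLinearMap.lsmul ℝ ℝ] D) x - D x‖ₑ ≤
      eLpNorm H Q volume * δ := by
  have hDl : LocallyIntegrable D volume := hD.locallyIntegrable hP1
  have hpt : ∀ x, ‖(ρ.normed volume ⋆[ContinuousLinearMap.lsmul ℝ ℝ] D) x - D x‖ₑ ≤
      ∫⁻ z, ‖ρ.normed volume z‖ₑ * ‖D (x - z) - D x‖ₑ := by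
    intro x
    have h1 : Integrable (fun z => ρ.normed volume z • D (x - z)) :=
      ρ.hasCompactSupport_normed.convolutionExists_left (ContinuousLinearMap.lsmul ℝ ℝ)
        ρ.continuous_normed hDl x
    have h2 : (ρ.normed volume ⋆[ContinuousLinearMap.lsmul ℝ ℝ] D) x - D x =
        ∫ z, ρ.normed volume z • (D (x - z) - D x) := by
      simp only [smul_sub]
      rw [integral_sub h1 (ρ.integrable_normed.smul_const _), ρ.integral_normed_smul]
      rfl
    rw [h2]
    refine (enorm_integral_le_lintegral_enorm _).trans_eq ?_
    simp only [enorm_smul]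
  have hmD : AEStronglyMeasurable (fun q : Rn n × Rn n => D (q.1 - q.2))
      (volume.prod volume) :=
    hD.1.comp_quasiMeasurePreserving
      (quasiMeasurePreserving_sub_of_right_invariant volume volume)
  have hmeas : AEMeasurable (Function.uncurry fun x z : Rn n =>
      ‖H x‖ₑ * (‖ρ.normed volume z‖ₑ * ‖D (x - z) - D x‖ₑ)) (volume.prod volume) :=
    hH.comp_fst.enorm.mul
      ((ρ.continuous_normed.comp continuous_snd).measurable.enorm.aemeasurable.mul
      (hmD.sub hD.1.comp_fst).enorm)
  have hHolder : ∀ z ∈ Metric.ball (0 : Rn n) ρ.rOut,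
      ∫⁻ x, ‖H x‖ₑ * ‖D (x - z) - D x‖ₑ ≤ eLpNorm H Q volume * δ := by
    intro z hz
    have hm : AEStronglyMeasurable (fun x => D (x - z) - D x) volume :=
      (hD.1.comp_quasiMeasurePreserving
        (measurePreserving_sub_right volume z).quasiMeasurePreserving).sub hD.1
    have := eLpNorm_smul_le_mul_eLpNorm (p := Q) (q := P) (r := 1) hm hH.norm
    rw [eLpNorm_one_eq_lintegral_enorm, eLpNorm_norm] at this
    simp only [Pi.smul_apply', enorm_smul, enorm_norm] at this
    exact this.trans (mul_le_mul_right (hδ z hz) _)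
  calc ∫⁻ x, ‖H x‖ₑ * ‖(ρ.normed volume ⋆[ContinuousLinearMap.lsmul ℝ ℝ] D) x - D x‖ₑ
      ≤ ∫⁻ x, ∫⁻ z, ‖H x‖ₑ * (‖ρ.normed volume z‖ₑ * ‖D (x - z) - D x‖ₑ) := by
        refine lintegral_mono fun x => ?_
        rw [lintegral_const_mul' _ _ enorm_ne_top]
        exact mul_le_mul_right (hpt x) _
    _ = ∫⁻ z, ∫⁻ x, ‖H x‖ₑ * (‖ρ.normed volume z‖ₑ * ‖D (x - z) - D x‖ₑ) :=
        lintegral_lintegral_swap hmeas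
    _ = ∫⁻ z, ‖ρ.normed volume z‖ₑ * ∫⁻ x, ‖H x‖ₑ * ‖D (x - z) - D x‖ₑ := by
        refine lintegral_congr fun z => ?_
        rw [← lintegral_const_mul' _ _ enorm_ne_top]
        refine lintegral_congr fun x => ?_
        ring
    _ ≤ ∫⁻ z, ‖ρ.normed volume z‖ₑ * (eLpNorm H Q volume * δ) := by
        refine lintegral_mono fun z => ?_
        by_cases hz : z ∈ Metric.ball (0 : Rn n) ρ.rOut
        · exact mul_le_mul_right (hHolder z hz) _
        · rw [← ρ.support_normed_eq (μ := volume), Function.notMem_support] at hz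
          simp [hz]
    _ = eLpNorm H Q volume * δ := by
        rw [lintegral_mul_const _ ρ.continuous_normed.measurable.enorm]
        have : ∫⁻ z, ‖ρ.normed volume z‖ₑ = 1 := by
          have h1 := ofReal_integral_eq_lintegral_ofReal (ρ.integrable_normed (μ := volume))
            (Eventually.of_forall fun z => ρ.nonneg_normed z)
          rw [ρ.integral_normed, ENNReal.ofReal_one] at h1
          rw [h1]
          refine lintegral_congr fun z => ?_
          rw [Real.enorm_eq_ofReal (ρ.nonneg_normed z)]
        rw [this, one_mul]

/-- The derivative falls on the kernel, and `y ↦ r (x - y)` is itself a test function supported in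
`U`, so the weak gradient identity moves it onto `D`. -/
theorem HasWeakGradientOn.hasGradientAt_convolution {n : ℕ} {U : Set (Rn n)} {v : Rn n → ℝ}
    {D : Rn n → Rn n} (hw : HasWeakGradientOn U v D) (hv : LocallyIntegrable v volume)
    {r : Rn n → ℝ} (hrs : ContDiff ℝ ((⊤ : ℕ∞) : WithTop ℕ∞) r) {R : ℝ}
    (hrR : Function.support r ⊆ Metric.closedBall 0 R) {x : Rn n}
    (hx : Metric.closedBall x R ⊆ U) :
    HasGradientAt (r ⋆[ContinuousLinearMap.lsmul ℝ ℝ] v)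
      ((r ⋆[ContinuousLinearMap.lsmul ℝ ℝ] D) x) x := by
  have hr1 : ContDiff ℝ 1 r := hrs.of_le (by exact_mod_cast le_top)
  have hrc : HasCompactSupport r :=
    HasCompactSupport.of_support_subset_isCompact (isCompact_closedBall 0 R) hrR
  obtain ⟨ψ, hψ⟩ : ∃ ψ : Rn n → ℝ, ψ = fun y => r (x - y) := ⟨_, rfl⟩
  have hψs : ContDiff ℝ ((⊤ : ℕ∞) : WithTop ℕ∞) ψ :=
    hψ ▸ hrs.comp (contDiff_const.sub contDiff_id)
  have hψ1 : ContDiff ℝ 1 ψ := hψ ▸ hr1.comp (contDiff_const.sub contDiff_id)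
  have hψt : tsupport ψ ⊆ Metric.closedBall x R := by
    refine closure_minimal (fun y hy => ?_) Metric.isClosed_closedBall
    have h : x - y ∈ Function.support r := by simpa [hψ] using hy
    have := hrR h
    rw [Metric.mem_closedBall, dist_zero_right, ← dist_eq_norm] at this
    rwa [Metric.mem_closedBall, dist_comm]
  have hψc : HasCompactSupport ψ :=
    (isCompact_closedBall x R).of_isClosed_subset (isClosed_tsupport ψ) hψt
  have hψf : ∀ y e, fderiv ℝ ψ y e = - fderiv ℝ r (x - y) e := by
    intro y e
    have h1 : HasFDerivAt (fun y => r (x - y)) _ y :=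
      ((hr1.differentiable one_ne_zero (x - y)).hasFDerivAt).comp y
        ((hasFDerivAt_id y).const_sub x)
    rw [hψ, h1.fderiv]
    simp
  have key := hw ψ hψs hψc (hψt.trans hx)
  have hF := hrc.hasFDerivAt_convolution_left (ContinuousLinearMap.lsmul ℝ ℝ) hr1 hv x
    (μ := volume)
  have hDx : (r ⋆[ContinuousLinearMap.lsmul ℝ ℝ] D) x = ∫ y, ψ y • D y := by
    rw [convolution_def, ← integral_sub_left_eq_self _ volume x, hψ]
    simp
  have hi1 := (hrc.fderiv ℝ).convolutionExists_left (μ := volume)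
    (ContinuousLinearMap.precompL (Rn n) (ContinuousLinearMap.lsmul ℝ ℝ : ℝ →L[ℝ] ℝ →L[ℝ] ℝ))
    (hr1.continuous_fderiv one_ne_zero) hv x
  have hi2 : Integrable (fun y => v y • gradient ψ y) :=
    hv.integrable_smul_right_of_hasCompactSupport (continuous_gradient hψ1)
      (hψc.mono' ((subset_tsupport _).trans (tsupport_gradient_subset ψ)))
  have hG : InnerProductSpace.toDual ℝ (Rn n) ((r ⋆[ContinuousLinearMap.lsmul ℝ ℝ] D) x) =
      (fderiv ℝ r ⋆[(ContinuousLinearMap.lsmul ℝ ℝ).precompL (Rn n)] v) x := by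
    ext e
    rw [InnerProductSpace.toDual_apply_apply, hDx, ← neg_eq_iff_eq_neg.2 key, convolution_def,
      ContinuousLinearMap.integral_apply hi1.integrable, inner_neg_left, real_inner_comm,
      ← integral_inner hi2, ← integral_neg]
    refine Eq.trans ?_ (integral_sub_left_eq_self _ volume x)
    refine integral_congr_ae (Eventually.of_forall fun y => ?_)
    beta_reduce
    rw [real_inner_smul_right, inner_gradient_eq_fderiv, hψf]
    simp [ContinuousLinearMap.precompL, mul_comm]
  rw [hasGradientAt_iff_hasFDerivAt, hG]
  exact hF

/-! ### Truncation and the test function -/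

theorem deriv_smoothTransition_nonneg (t : ℝ) : 0 ≤ deriv Real.smoothTransition t :=
  Real.smoothTransition.monotone.deriv_nonneg

theorem deriv_smoothTransition_of_nonpos {t : ℝ} (ht : t ≤ 0) :
    deriv Real.smoothTransition t = 0 :=
  IsLocalMin.deriv_eq_zero (Eventually.of_forall fun y => by
    rw [Real.smoothTransition.zero_of_nonpos ht]
    exact Real.smoothTransition.nonneg y)

theorem deriv_smoothTransition_of_one_le {t : ℝ} (ht : 1 ≤ t) :
    deriv Real.smoothTransition t = 0 :=
  IsLocalMax.deriv_eq_zero (Eventually.of_forall fun y => by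
    rw [Real.smoothTransition.one_of_one_le ht]
    exact Real.smoothTransition.le_one y)

theorem continuous_deriv_smoothTransition : Continuous (deriv Real.smoothTransition) :=
  (Real.smoothTransition.contDiff (n := 1)).continuous_deriv (by norm_num)

theorem exists_deriv_smoothTransition_le :
    ∃ M : ℝ, 0 ≤ M ∧ ∀ t, deriv Real.smoothTransition t ≤ M := by
  obtain ⟨M, hM⟩ := (isCompact_Icc (a := (0 : ℝ)) (b := 1)).exists_bound_of_continuousOn
    continuous_deriv_smoothTransition.continuousOn
  have hM0 : 0 ≤ M := (norm_nonneg _).trans (hM 0 (by simp))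
  refine ⟨M, hM0, fun t => ?_⟩
  rcases le_or_gt t 0 with h | h
  · rwa [deriv_smoothTransition_of_nonpos h]
  rcases le_or_gt 1 t with h' | h'
  · rwa [deriv_smoothTransition_of_one_le h']
  · exact (le_abs_self _).trans (hM t ⟨h.le, h'.le⟩)

theorem hasGradientAt_comp {n : ℕ} {T : ℝ → ℝ} {w : Rn n → ℝ} {x d : Rn n}
    (hT : DifferentiableAt ℝ T (w x)) (hw : HasGradientAt w d x) :
    HasGradientAt (fun y => T (w y)) (deriv T (w x) • d) x := by
  rw [hasGradientAt_iff_hasFDerivAt] at hw ⊢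
  have h := hT.hasDerivAt.comp_hasFDerivAt x hw
  rwa [← map_smul] at h

/-- Smooth nonnegative test functions obtained by mollifying and truncating a function `v` with a
strict interior peak at `x₀`, whose gradients pair almost non-positively with a field `H` that pairs
non-positively with the weak gradient of `v`. -/
theorem HasWeakGradientOn.exists_testFunction {n : ℕ} {x₀ : Rn n} {s m : ℝ} (hs : 0 < s)
    (hm : 0 < m) {P Q : ENNReal} (hP1 : 1 ≤ P) (hP : P ≠ ⊤) [Q.HolderTriple P 1]
    {v : Rn n → ℝ} {D H : Rn n → Rn n} (hv : Integrable v)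
    (hvc : ContinuousOn v (Metric.closedBall x₀ (3 * s))) (hD : MemLp D P volume)
    (hH : MemLp H Q volume) (hw : HasWeakGradientOn (Metric.ball x₀ (3 * s)) v D)
    (hv0 : v x₀ = 0) (hvm : ∀ x ∈ Metric.closedBall x₀ (3 * s), s ≤ dist x x₀ → v x ≤ -m)
    (hHD : ∀ x, ⟪H x, D x⟫ ≤ 0) :
    ∃ c > 0, ∀ ε > 0, ∃ ψ : Rn n → ℝ, ContDiff ℝ ((⊤ : ℕ∞) : WithTop ℕ∞) ψ ∧
      tsupport ψ ⊆ Metric.closedBall x₀ (2 * s) ∧ (∀ x, 0 ≤ ψ x) ∧ c ≤ ∫ x, ψ x ∧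
      ∫ x, ⟪H x, gradient ψ x⟫ ≤ ε := by
  obtain ⟨M, hM0, hM⟩ := exists_deriv_smoothTransition_le
  let χ : ContDiffBump x₀ := ⟨s, 2 * s, hs, by linarith⟩
  obtain ⟨δ₁, hδ₁, huc⟩ := Metric.uniformContinuousOn_iff.1
    ((isCompact_closedBall x₀ (3 * s)).uniformContinuousOn_of_continuous hvc) (m / 8)
    (by positivity)
  set t := min δ₁ s with ht
  have ht0 : 0 < t := lt_min hδ₁ hs
  -- On the ball of radius `t`, `v > -m/8` and the mollification loses at most `m/8`, so the
  -- truncation argument `w + m/2` exceeds `m/4`. The constant does not depend on `ε`.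
  refine ⟨Real.smoothTransition (m / 4) * volume.real (Metric.ball x₀ t), mul_pos
    (Real.smoothTransition.pos_of_pos (by positivity))
    (ENNReal.toReal_pos (Metric.measure_ball_pos volume x₀ ht0).ne' measure_ball_lt_top.ne),
    fun ε hε => ?_⟩
  set A := (eLpNorm H Q volume).toReal with hA
  have hd : 0 < ε / (M * A + 1) := by positivity
  obtain ⟨δ₂, hδ₂, htr⟩ := Metric.eventually_nhds_iff_ball.1
    ((tendsto_eLpNorm_translate_sub hP1 hP hD).eventually_le_const (ENNReal.ofReal_pos.2 hd))
  -- The mollification radius makes translates of `D` close (`δ₂`), makes `w` within `m/8` of `v`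
  -- (`δ₁`), and keeps balls about points of the `2s`-ball inside the `3s`-ball.
  set h := min δ₂ (min δ₁ (s / 2)) with hh
  have hh0 : 0 < h := lt_min hδ₂ (lt_min hδ₁ (by positivity))
  have hh2 : h ≤ δ₂ := min_le_left _ _
  have hh1 : h ≤ δ₁ := (min_le_right _ _).trans (min_le_left _ _)
  have hhs : h ≤ s / 2 := (min_le_right _ _).trans (min_le_right _ _)
  let ρ : ContDiffBump (0 : Rn n) := ⟨h / 2, h, by positivity, by linarith⟩
  have hρo : ρ.rOut = h := rfl
  have hvl : LocallyIntegrable v volume := hv.locallyIntegrable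
  have hDl : LocallyIntegrable D volume := hD.locallyIntegrable hP1
  obtain ⟨w, hwdef⟩ : ∃ w : Rn n → ℝ,
    w = (ρ.normed volume ⋆[ContinuousLinearMap.lsmul ℝ ℝ] v) := ⟨_, rfl⟩
  obtain ⟨E, hEdef⟩ : ∃ E : Rn n → Rn n,
    E = (ρ.normed volume ⋆[ContinuousLinearMap.lsmul ℝ ℝ] D) := ⟨_, rfl⟩
  have hws : ContDiff ℝ ((⊤ : ℕ∞) : WithTop ℕ∞) w := by
    rw [hwdef]
    exact ρ.hasCompactSupport_normed.contDiff_convolution_left _ ρ.contDiff_normed hvl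
  have hEc : Continuous E := by
    rw [hEdef]
    exact (ρ.hasCompactSupport_normed.contDiff_convolution_left (n := 0) _ ρ.contDiff_normed
      hDl).continuous
  have hwv : ∀ x ∈ Metric.closedBall x₀ (2 * s), |w x - v x| ≤ m / 8 := by
    intro x hx
    rw [← Real.dist_eq, hwdef]
    refine ρ.dist_normed_convolution_le hv.1 fun y hy => ?_
    rw [Metric.mem_closedBall] at hx
    rw [hρo, Metric.mem_ball] at hy
    refine (huc y ?_ x ?_ (hy.trans_le hh1)).le
    · rw [Metric.mem_closedBall]
      linarith [dist_triangle y x x₀]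
    · rw [Metric.mem_closedBall]
      linarith
  have hwg : ∀ x ∈ Metric.closedBall x₀ (2 * s), HasGradientAt w (E x) x := by
    intro x hx
    rw [hwdef, hEdef]
    refine hw.hasGradientAt_convolution hvl ρ.contDiff_normed (R := h) ?_ ?_
    · rw [ρ.support_normed_eq, hρo]
      exact Metric.ball_subset_closedBall
    · refine Metric.closedBall_subset_ball' ?_
      rw [Metric.mem_closedBall] at hx
      linarith
  have hT1 : Differentiable ℝ Real.smoothTransition :=
    (Real.smoothTransition.contDiff (n := 1)).differentiable (by norm_num)
  obtain ⟨ψ, hψ⟩ : ∃ ψ : Rn n → ℝ,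
    ψ = fun x => χ x * Real.smoothTransition (w x + m / 2) := ⟨_, rfl⟩
  have hψs : ContDiff ℝ ((⊤ : ℕ∞) : WithTop ℕ∞) ψ := by
    rw [hψ]
    exact χ.contDiff.mul (Real.smoothTransition.contDiff.comp (hws.add contDiff_const))
  have hψt : tsupport ψ ⊆ Metric.closedBall x₀ (2 * s) := by
    rw [hψ]
    exact (tsupport_mul_subset_left).trans χ.tsupport_eq.subset
  have hψ0 : ∀ x, 0 ≤ ψ x := fun x => by
    rw [hψ]
    exact mul_nonneg χ.nonneg (Real.smoothTransition.nonneg _)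
  have hψc : HasCompactSupport ψ :=
    (isCompact_closedBall x₀ (2 * s)).of_isClosed_subset (isClosed_tsupport ψ) hψt
  have hgrad : ∀ x, gradient ψ x =
      (χ x * deriv Real.smoothTransition (w x + m / 2)) • E x := by
    intro x
    by_cases hx : x ∈ Metric.closedBall x₀ (2 * s)
    · have hg1 : HasGradientAt (fun y => w y + m / 2) (E x) x := by
        have := (hwg x hx).hasFDerivAt.add_const (m / 2)
        exact hasGradientAt_iff_hasFDerivAt.2 this
      have hg2 := hasGradientAt_comp (hT1 (w x + m / 2)) hg1
      -- The cutoff contributes nothing: for `dist x x₀ < s` it is locally constant, and beyond that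
      -- `w ≤ -7m/8`, so the truncation vanishes.
      have hz : Real.smoothTransition (w x + m / 2) • gradient χ x = 0 := by
        rcases lt_or_ge (dist x x₀) s with hlt | hge
        · have : (χ : Rn n → ℝ) =ᶠ[𝓝 x] fun _ => 1 :=
            χ.eventuallyEq_one_of_mem_ball hlt
          rw [gradient, this.fderiv_eq]
          simp
        · have h1 := hvm x (Metric.closedBall_subset_closedBall (by linarith) hx) hge
          have h2 := (abs_le.1 (hwv x hx)).2
          rw [Real.smoothTransition.zero_of_nonpos (by linarith), zero_smul]
      rw [hψ, gradient_mul ((χ.contDiff (n := 1)).differentiable (by norm_num) x)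
        hg2.differentiableAt, hz, add_zero, hg2.gradient, smul_smul]
    · have h1 : x ∉ tsupport (gradient ψ) := fun h' => hx (hψt (tsupport_gradient_subset ψ h'))
      have h2 : χ x = 0 := χ.zero_of_le_dist (by
        rw [Metric.mem_closedBall, not_le] at hx
        exact hx.le)
      rw [image_eq_zero_of_notMem_tsupport h1, h2, zero_mul, zero_smul]
  refine ⟨ψ, hψs, hψt, hψ0, ?_, ?_⟩
  · have hψi : Integrable ψ := hψs.continuous.integrable_of_hasCompactSupport hψc
    refine le_trans ?_ (setIntegral_le_integral (s := Metric.ball x₀ t) hψi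
      (Eventually.of_forall hψ0))
    have h1 : ∀ x ∈ Metric.ball x₀ t, Real.smoothTransition (m / 4) ≤ ψ x := by
      intro x hx
      rw [Metric.mem_ball] at hx
      have hxs : dist x x₀ < s := hx.trans_le (min_le_right _ _)
      have hxδ : dist x x₀ < δ₁ := hx.trans_le (min_le_left _ _)
      have h2 := huc x (Metric.mem_closedBall.2 (by linarith)) x₀
        (Metric.mem_closedBall_self (by linarith)) hxδ
      rw [hv0, Real.dist_eq, sub_zero, abs_lt] at h2
      have h3 := (abs_le.1 (hwv x (Metric.mem_closedBall.2 (by linarith)))).1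
      have h4 : χ x = 1 := χ.one_of_mem_closedBall (Metric.mem_closedBall.2 hxs.le)
      rw [hψ]
      beta_reduce
      rw [h4, one_mul]
      exact Real.smoothTransition.monotone (by linarith)
    have h2 := setIntegral_mono_on (μ := volume)
      (integrableOn_const (C := Real.smoothTransition (m / 4))
        (measure_ball_lt_top (x := x₀) (r := t)).ne)
      hψi.integrableOn measurableSet_ball h1
    rw [setIntegral_const, smul_eq_mul, mul_comm] at h2
    exact h2
  -- Without integrability the integral is `0` by convention, and the bound is trivial.
  · by_cases hi : Integrable (fun x => ⟪H x, gradient ψ x⟫)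
    swap
    · rw [integral_undef hi]
      exact hε.le
    have hb := lintegral_enorm_mul_convolution_sub_le (Q := Q) hP1 ρ hD hH.1
      (δ := ENNReal.ofReal (ε / (M * A + 1)))
      (fun z hz => htr z (Metric.ball_subset_ball hh2 hz))
    rw [← hEdef] at hb
    have hlt : eLpNorm H Q volume * ENNReal.ofReal (ε / (M * A + 1)) < ⊤ :=
      ENNReal.mul_lt_top hH.2 ENNReal.ofReal_lt_top
    have he : ∫⁻ x, ‖‖H x‖ * ‖E x - D x‖‖ₑ = ∫⁻ x, ‖H x‖ₑ * ‖E x - D x‖ₑ := by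
      simp only [enorm_mul, enorm_norm]
    have hgi : Integrable (fun x => ‖H x‖ * ‖E x - D x‖) :=
      ⟨hH.1.norm.mul (hEc.aestronglyMeasurable.sub hD.1).norm, by
        rw [HasFiniteIntegral, he]
        exact hb.trans_lt hlt⟩
    have hgb : ∫ x, ‖H x‖ * ‖E x - D x‖ ≤ A * (ε / (M * A + 1)) := by
      have h1 := integral_norm_eq_lintegral_enorm hgi.1
      rw [he] at h1
      have h2 : ∫ x, ‖H x‖ * ‖E x - D x‖ = ∫ x, ‖‖H x‖ * ‖E x - D x‖‖ :=
        integral_congr_ae (Eventually.of_forall fun x => by simp)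
      rw [h2, h1]
      refine (ENNReal.toReal_mono hlt.ne hb).trans_eq ?_
      rw [ENNReal.toReal_mul, ENNReal.toReal_ofReal hd.le]
    calc ∫ x, ⟪H x, gradient ψ x⟫ ≤ ∫ x, M * (‖H x‖ * ‖E x - D x‖) := by
          refine integral_mono hi (hgi.const_mul M) fun x => ?_
          beta_reduce
          rw [hgrad x, real_inner_smul_right]
          have hk0 : 0 ≤ χ x * deriv Real.smoothTransition (w x + m / 2) :=
            mul_nonneg χ.nonneg (deriv_smoothTransition_nonneg _)
          have hkM : χ x * deriv Real.smoothTransition (w x + m / 2) ≤ M :=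
            (mul_le_of_le_one_left (deriv_smoothTransition_nonneg _) χ.le_one).trans (hM _)
          -- Split `E = D + (E - D)`; the pairing with `D` is non-positive.
          have h1 : ⟪H x, E x⟫ ≤ ‖H x‖ * ‖E x - D x‖ := by
            have h2 := real_inner_le_norm (H x) (E x - D x)
            rw [inner_sub_right] at h2
            linarith [hHD x]
          exact (mul_le_mul_of_nonneg_left h1 hk0).trans
            (mul_le_mul_of_nonneg_right hkM (by positivity))
      _ ≤ M * (A * (ε / (M * A + 1))) := by
          rw [integral_const_mul]
          exact mul_le_mul_of_nonneg_left hgb hM0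
      _ = ε * (M * A / (M * A + 1)) := by ring
      _ ≤ ε * 1 := by
          refine mul_le_mul_of_nonneg_left ?_ hε.le
          rw [div_le_one (by positivity)]
          linarith
      _ = ε := mul_one ε

/-! ### Comparison with a strict classical subsolution -/

theorem ContinuousOn.integrable_smul_gradient {n : ℕ} {U : Set (Rn n)} (hU : IsOpen U)
    {a : Rn n → ℝ} (ha : ContinuousOn a U) {ψ : Rn n → ℝ} (hψ : ContDiff ℝ 1 ψ)
    (hc : HasCompactSupport ψ) (hs : tsupport ψ ⊆ U) :
    Integrable (fun x => a x • gradient ψ x) := by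
  have hsupp : Function.support (fun x => a x • gradient ψ x) ⊆ tsupport ψ := fun x hx => by
    contrapose! hx
    have : x ∉ tsupport (gradient ψ) := fun h => hx (tsupport_gradient_subset ψ h)
    rw [Function.notMem_support, image_eq_zero_of_notMem_tsupport this, smul_zero]
  have h1 : Continuous (fun x => a x • gradient ψ x) :=
    (ha.smul (continuous_gradient hψ).continuousOn).continuous_of_tsupport_subset hU
      ((closure_minimal hsupp (isClosed_tsupport ψ)).trans hs)
  exact h1.integrable_of_hasCompactSupport
    (HasCompactSupport.of_support_subset_isCompact hc hsupp)

theorem integral_smul_gradient_eq_neg {n : ℕ} {U : Set (Rn n)} (hU : IsOpen U)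
    {a : Rn n → ℝ} (ha : ContDiffOn ℝ 1 a U) (hag : ContinuousOn (gradient a) U)
    {ψ : Rn n → ℝ} (hψ : ContDiff ℝ 1 ψ)
    (hc : HasCompactSupport ψ) (hs : tsupport ψ ⊆ U) :
    ∫ x, a x • gradient ψ x = - ∫ x, ψ x • gradient a x := by
  refine ext_inner_left ℝ fun e => ?_
  rw [inner_neg_right, ← integral_inner (ha.continuousOn.integrable_smul_gradient hU hψ hc hs),
    ← integral_inner (hag.integrable_smul_of_tsupport_subset hU hψ.continuous hc hs).2]
  simp only [real_inner_smul_right, inner_gradient_eq_fderiv]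
  rw [(integral_mul_fderiv_of_contDiffOn hU ha hψ hc hs e).2.2]
  simp only [mul_comm]

theorem setIntegral_eq_integral_of_tsupport_subset {n : ℕ} {F : Type*} [NormedAddCommGroup F]
    [NormedSpace ℝ F] {U : Set (Rn n)} {ψ : Rn n → ℝ} (hs : tsupport ψ ⊆ U) {g : Rn n → F}
    (hg : ∀ x, x ∉ tsupport ψ → g x = 0) : ∫ x in U, g x = ∫ x, g x :=
  setIntegral_eq_integral_of_forall_compl_eq_zero fun x hx => hg x fun h => hx (hs h)

theorem gradient_eq_zero_of_notMem_tsupport {n : ℕ} {ψ : Rn n → ℝ} {x : Rn n}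
    (hx : x ∉ tsupport ψ) : gradient ψ x = 0 :=
  image_eq_zero_of_notMem_tsupport fun h => hx (tsupport_gradient_subset ψ h)

theorem MemLp.pFlux_comp {α : Type*} {_ : MeasurableSpace α} {μ : Measure α} {n : ℕ} {p : ℝ}
    (hp : 1 < p) {G : α → Rn n} (hG : MemLp G (ENNReal.ofReal p) μ) :
    MemLp (fun x => pFlux p (G x)) (ENNReal.ofReal (p / (p - 1))) μ := by
  have h := hG.norm_rpow_div (ENNReal.ofReal (p - 1))
  rw [ENNReal.toReal_ofReal (by linarith), ← ENNReal.ofReal_div_of_pos (by linarith)] at h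
  refine h.congr_norm ((continuous_pFlux hp).comp_aestronglyMeasurable hG.1)
    (Eventually.of_forall fun x => ?_)
  rw [norm_pFlux hp, Real.norm_of_nonneg (by positivity)]

theorem ContinuousOn.memLp_restrict_of_isCompact {n : ℕ} {F : Type*} [NormedAddCommGroup F]
    {K : Set (Rn n)} (hK : IsCompact K) {g : Rn n → F} (hg : ContinuousOn g K) (q : ENNReal) :
    MemLp g q (volume.restrict K) := by
  have : IsFiniteMeasure (volume.restrict K) := ⟨by simpa using hK.measure_lt_top⟩
  obtain ⟨C, hC⟩ := hK.exists_bound_of_continuousOn hg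
  exact MemLp.of_bound (hg.aestronglyMeasurable_of_isCompact hK hK.measurableSet) C
    ((ae_restrict_iff' hK.measurableSet).2 (Eventually.of_forall hC))

theorem ContDiffOn.pFlux_gradient {n : ℕ} (p : ℝ) {U : Set (Rn n)} (hU : IsOpen U)
    {φ : Rn n → ℝ} (hφ : ContDiffOn ℝ 2 φ U) (h : ∀ x ∈ U, gradient φ x ≠ 0) :
    ContDiffOn ℝ 1 (fun x => pFlux p (gradient φ x)) U := fun x hx =>
  (contDiffAt_pFlux p (h x hx)).comp_contDiffWithinAt x (contDiffOn_gradient hU hφ x hx)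

/-- A weak supersolution cannot be touched strictly from below by a strict classical
subsolution. -/
theorem HasW1pLocGradient.not_touching_of_neg_pLaplacian_lt {n : ℕ} (hn : 1 ≤ n) {p : ℝ}
    (hp : 1 < p) {Ω : Opens (Rn n)} {u g : Rn n → ℝ} {G : Rn n → Rn n}
    (hG : HasW1pLocGradient p Ω u G) (hu : ContinuousOn u (Ω : Set (Rn n)))
    (hsuper : ∀ ψ : 𝓓(Ω, ℝ), (∀ x, 0 ≤ ψ x) →
      IntegrableOn (fun x => g x * ψ x) (Ω : Set (Rn n)) ∧
      ∫ x in (Ω : Set (Rn n)), g x * ψ x ≤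
        ∫ x in (Ω : Set (Rn n)), ⟪pFlux p (G x), gradient ψ x⟫)
    {x₀ : Rn n} {r : ℝ} (hr : 0 < r) (hball : Metric.ball x₀ r ⊆ (Ω : Set (Rn n)))
    {φ : Rn n → ℝ} (hφ : ContDiffOn ℝ 2 φ (Metric.ball x₀ r))
    (hgrad : ∀ x ∈ Metric.ball x₀ r, x ≠ x₀ → gradient φ x ≠ 0) {C C' : ℝ} (hCC : C < C')
    (hlap : ∀ x ∈ Metric.ball x₀ r, x ≠ x₀ → -pLaplacian p φ x ≤ C)
    (hg : ∀ x ∈ Metric.ball x₀ r, C' ≤ g x) (hlt : ∀ x ∈ Metric.ball x₀ r, x ≠ x₀ → φ x < u x) :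
    φ x₀ ≠ u x₀ := by
  intro hcontact
  set U := Metric.ball x₀ r with hUdef
  have hU : IsOpen U := Metric.isOpen_ball
  obtain ⟨s, hs, hsr⟩ : ∃ s : ℝ, 0 < s ∧ 4 * s = r := ⟨r / 4, by positivity, by ring⟩
  set K := Metric.closedBall x₀ (3 * s) with hKdef
  have hK : IsCompact K := isCompact_closedBall _ _
  have hKm : MeasurableSet K := hK.measurableSet
  have hKU : K ⊆ U := Metric.closedBall_subset_ball (by linarith)
  have hKΩ : K ⊆ (Ω : Set (Rn n)) := hKU.trans hball
  have hφc : ContinuousOn φ U := hφ.continuousOn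
  have hφg : ContinuousOn (gradient φ) U := (contDiffOn_gradient hU hφ).continuousOn
  have hvc : ContinuousOn (fun x => φ x - u x) K := (hφc.mono hKU).sub (hu.mono hKΩ)
  have hGK := hG.memLpLoc_grad K hK hKΩ
  set P := ENNReal.ofReal p
  set Q := ENNReal.ofReal (p / (p - 1))
  have hPQ : Q.HolderTriple P 1 := by
    have h1 : p.HolderConjugate (p / (p - 1)) := Real.HolderConjugate.conjExponent hp
    have := h1.symm.ennrealOfReal
    exact this
  have hP1 : 1 ≤ P := ENNReal.one_le_ofReal.2 hp.le
  have hΦc : ContinuousOn (fun x => pFlux p (gradient φ x)) U :=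
    (continuous_pFlux hp).comp_continuousOn hφg
  have hD : MemLp (K.indicator fun x => gradient φ x - G x) P volume :=
    (memLp_indicator_iff_restrict hKm).2
      (((hφg.mono hKU).memLp_restrict_of_isCompact hK P).sub hGK)
  have hVG : MemLp (K.indicator fun x => pFlux p (G x)) Q volume :=
    (memLp_indicator_iff_restrict hKm).2 (MemLp.pFlux_comp hp hGK)
  have hH : MemLp (K.indicator fun x => pFlux p (G x) - pFlux p (gradient φ x)) Q volume :=
    (memLp_indicator_iff_restrict hKm).2
      ((MemLp.pFlux_comp hp hGK).sub ((hΦc.mono hKU).memLp_restrict_of_isCompact hK Q))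
  have hv : Integrable (K.indicator fun x => φ x - u x) :=
    (integrable_indicator_iff hKm).2 (hvc.integrableOn_compact hK)
  have hGl : LocallyIntegrable (K.indicator G) volume :=
    ((memLp_indicator_iff_restrict hKm).2 hGK).locallyIntegrable hP1
  have hw : HasWeakGradientOn (Metric.ball x₀ (3 * s)) (K.indicator fun x => φ x - u x)
      (K.indicator fun x => gradient φ x - G x) := by
    intro ψ hψ hψc hψs
    have hψK : tsupport ψ ⊆ K := hψs.trans Metric.ball_subset_closedBall
    have hψU : tsupport ψ ⊆ U := hψK.trans hKU
    have hψ1 : ContDiff ℝ 1 ψ := hψ.of_le (by exact_mod_cast le_top)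
    have h1 := hG.integral_eq ⟨ψ, hψ, hψc, hψK.trans hKΩ⟩
    change ∫ x in (Ω : Set (Rn n)), u x • gradient ψ x =
      - ∫ x in (Ω : Set (Rn n)), ψ x • G x at h1
    rw [setIntegral_eq_integral_of_tsupport_subset (hψK.trans hKΩ) fun x hx => by
        rw [gradient_eq_zero_of_notMem_tsupport hx, smul_zero],
      setIntegral_eq_integral_of_tsupport_subset (hψK.trans hKΩ) fun x hx => by
        rw [image_eq_zero_of_notMem_tsupport hx, zero_smul]] at h1
    have h2 := integral_smul_gradient_eq_neg hU (hφ.of_le (by norm_num)) hφg hψ1 hψc hψU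
    have hi1 := hφc.integrable_smul_gradient hU hψ1 hψc hψU
    have hi2 := (hu.mono hball).integrable_smul_gradient hU hψ1 hψc hψU
    have hi3 := (hφg.integrable_smul_of_tsupport_subset hU hψ1.continuous hψc hψU).2
    have hi4 : Integrable (fun x => ψ x • G x) := by
      refine (hGl.integrable_smul_left_of_hasCompactSupport hψ1.continuous hψc).congr
        (Eventually.of_forall fun x => ?_)
      by_cases hx : x ∈ K
      · simp [hx]
      · simp [image_eq_zero_of_notMem_tsupport fun h => hx (hψK h)]
    have e1 : ∀ x, (K.indicator (fun x => φ x - u x) x) • gradient ψ x =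
        φ x • gradient ψ x - u x • gradient ψ x := by
      intro x
      by_cases hx : x ∈ K
      · simp [hx, sub_smul]
      · simp [gradient_eq_zero_of_notMem_tsupport fun h => hx (hψK h)]
    have e2 : ∀ x, ψ x • (K.indicator (fun x => gradient φ x - G x) x) =
        ψ x • gradient φ x - ψ x • G x := by
      intro x
      by_cases hx : x ∈ K
      · simp [hx, smul_sub]
      · simp [image_eq_zero_of_notMem_tsupport fun h => hx (hψK h)]
    simp only [e1, e2]
    rw [integral_sub hi1 hi2, integral_sub hi3 hi4, h1, h2]
    abel
  -- Take `-m` to be the maximum of `φ - u` on the compact annulus, negative because contact is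
  -- strict.
  obtain ⟨m, hm, hvm⟩ : ∃ m > 0, ∀ x ∈ K, s ≤ dist x x₀ → φ x - u x ≤ -m := by
    have hS : IsCompact (K ∩ {x | s ≤ dist x x₀}) :=
      hK.inter_right (isClosed_le continuous_const (continuous_id.dist continuous_const))
    rcases (K ∩ {x | s ≤ dist x x₀}).eq_empty_or_nonempty with hE | hE
    · exact ⟨1, one_pos, fun x hx hxs => 
        absurd (show x ∈ K ∩ {x | s ≤ dist x x₀} from ⟨hx, hxs⟩)
          (hE ▸ Set.notMem_empty x)⟩
    · obtain ⟨y, hy, hmax⟩ := hS.exists_isMaxOn hE (hvc.mono Set.inter_subset_left)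
      have hyx : y ≠ x₀ := by
        rintro rfl
        have : s ≤ dist y y := hy.2
        rw [dist_self] at this
        linarith
      refine ⟨u y - φ y, sub_pos.2 (hlt y (hKU hy.1) hyx), fun x hx hxs => ?_⟩
      have := hmax (⟨hx, hxs⟩ : x ∈ K ∩ {x | s ≤ dist x x₀})
      simp only [Set.mem_ofPred_eq] at this
      linarith
  have hx₀K : x₀ ∈ K := Metric.mem_closedBall_self (by linarith)
  obtain ⟨c, hc, hex⟩ := hw.exists_testFunction (Q := Q) hs hm hP1 ENNReal.ofReal_ne_top hv
    (hvc.congr fun x hx => Set.indicator_of_mem hx _) hD hH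
    (by simp [hx₀K, hcontact]) (fun x hx hxs => by
      rw [Set.indicator_of_mem hx]
      exact hvm x hx hxs) (fun x => by
      by_cases hx : x ∈ K
      · rw [Set.indicator_of_mem hx, Set.indicator_of_mem hx]
        have := inner_pFlux_sub_nonneg hp (G x) (gradient φ x)
        rw [← neg_sub (G x), inner_neg_right]
        linarith
      · simp [hx])
  -- Half of the lower bound `(C' - C) c` that the two weak inequalities impose on `∫ H·∇ψ`.
  obtain ⟨ψ, hψ, hψt, hψ0, hψc, hψε⟩ := hex ((C' - C) * c / 2)
    (by have := sub_pos.2 hCC; positivity)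
  have hψcs : HasCompactSupport ψ :=
    (isCompact_closedBall x₀ (2 * s)).of_isClosed_subset (isClosed_tsupport ψ) hψt
  have hψK : tsupport ψ ⊆ K := hψt.trans (Metric.closedBall_subset_closedBall (by linarith))
  have hψU : tsupport ψ ⊆ U := hψK.trans hKU
  have hψ1 : ContDiff ℝ 1 ψ := hψ.of_le (by exact_mod_cast le_top)
  have hψi : Integrable ψ := hψ1.continuous.integrable_of_hasCompactSupport hψcs
  obtain ⟨hgi, hsup⟩ := hsuper ⟨ψ, hψ, hψcs, hψK.trans hKΩ⟩ hψ0
  change IntegrableOn (fun x => g x * ψ x) (Ω : Set (Rn n)) at hgi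
  change ∫ x in (Ω : Set (Rn n)), g x * ψ x ≤
        ∫ x in (Ω : Set (Rn n)), ⟪pFlux p (G x), gradient ψ x⟫ at hsup
  rw [setIntegral_eq_integral_of_tsupport_subset (hψK.trans hKΩ) (g := fun x =>
    ⟪pFlux p (G x), gradient ψ x⟫) fun x hx => by
      rw [gradient_eq_zero_of_notMem_tsupport hx, inner_zero_right]] at hsup
  have hlow : C' * ∫ x, ψ x ≤ ∫ x in (Ω : Set (Rn n)), g x * ψ x := by
    rw [← integral_const_mul, ← setIntegral_eq_integral_of_tsupport_subset (hψK.trans hKΩ)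
      (g := fun x => C' * ψ x) fun x hx => by
        rw [image_eq_zero_of_notMem_tsupport hx, mul_zero]]
    refine setIntegral_mono (hψi.const_mul C').integrableOn hgi fun x => ?_
    by_cases hx : x ∈ tsupport ψ
    · exact mul_le_mul_of_nonneg_right (hg x (hψU hx)) (hψ0 x)
    · simp [image_eq_zero_of_notMem_tsupport hx]
  have hup := integral_inner_gradient_le_of_neg_divergence_le hn hU (x₀ := x₀) hΦc
    ((hφ.mono Set.sdiff_subset).pFlux_gradient p (hU.sdiff isClosed_singleton)
      fun x hx => hgrad x hx.1 hx.2) (C := C)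
    (fun x hx => hlap x hx.1 hx.2) hψ1 hψcs hψU hψ0
  have hi1 : Integrable (fun x => ⟪pFlux p (G x), gradient ψ x⟫) := by
    obtain ⟨B, hB⟩ := (hψcs.mono' ((subset_tsupport _).trans
      (tsupport_gradient_subset ψ))).exists_bound_of_continuous (continuous_gradient hψ1)
    have hQ1 : 1 ≤ Q := by
      refine ENNReal.one_le_ofReal.2 ?_
      rw [le_div_iff₀ (by linarith)]
      linarith
    have : IsFiniteMeasure (volume.restrict K) := ⟨by simpa using hK.measure_lt_top⟩
    have hVi : Integrable (K.indicator fun x => pFlux p (G x)) :=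
      (integrable_indicator_iff hKm).2
        (((memLp_indicator_iff_restrict hKm).1 hVG).integrable hQ1)
    have h : Integrable (fun x => ⟪K.indicator (fun x => pFlux p (G x)) x, gradient ψ x⟫) :=
      (hVi.norm.mul_const B).mono'
        (hVi.1.inner (continuous_gradient hψ1).aestronglyMeasurable)
        (Eventually.of_forall fun x => (norm_inner_le_norm _ _).trans
          (mul_le_mul_of_nonneg_left (hB x) (norm_nonneg _)))
    refine h.congr (Eventually.of_forall fun x => ?_)
    by_cases hx : x ∈ K
    · simp only [Set.indicator_of_mem hx]
    · simp only [gradient_eq_zero_of_notMem_tsupport fun h => hx (hψK h), inner_zero_right]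
  have hi2 := hΦc.integrable_inner_gradient hU hψ1 hψcs hψU
  have hsplit : ∫ x, ⟪K.indicator (fun x => pFlux p (G x) - pFlux p (gradient φ x)) x,
      gradient ψ x⟫ = (∫ x, ⟪pFlux p (G x), gradient ψ x⟫) -
        ∫ x, ⟪pFlux p (gradient φ x), gradient ψ x⟫ := by
    rw [← integral_sub hi1 hi2]
    refine integral_congr_ae (Eventually.of_forall fun x => ?_)
    by_cases hx : x ∈ K
    · simp only [Set.indicator_of_mem hx, inner_sub_left]
    · simp only [gradient_eq_zero_of_notMem_tsupport fun h => hx (hψK h), inner_zero_right,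
        sub_zero]
  rw [hsplit] at hψε
  have h1 : (C' - C) * c ≤ (C' - C) * ∫ x, ψ x :=
    mul_le_mul_of_nonneg_left hψc (sub_nonneg.2 hCC.le)
  have h2 : 0 < (C' - C) * c := mul_pos (sub_pos.2 hCC) hc
  linarith

/-! ### The quartic perturbation -/

theorem hasGradientAt_norm_sub_pow_four {n : ℕ} (y x : Rn n) :
    HasGradientAt (fun z : Rn n => ‖z - y‖ ^ 4) ((4 * ‖x - y‖ ^ 2) • (x - y)) x := by
  rw [hasGradientAt_iff_hasFDerivAt]
  have h1 : HasFDerivAt (fun z : Rn n => ‖z - y‖ ^ 2) _ x :=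
    ((hasFDerivAt_id x).sub_const y).norm_sq
  have e : (fun z : Rn n => ‖z - y‖ ^ 4) = fun z => (‖z - y‖ ^ 2) ^ 2 := by
    ext z
    ring
  rw [e]
  refine (h1.pow 2).congr_fderiv ?_
  ext e
  rw [InnerProductSpace.toDual_apply_apply, real_inner_smul_left, inner_sub_left]
  simp
  ring

theorem hasFDerivAt_gradient_norm_sub_pow_four {n : ℕ} (y : Rn n) :
    HasFDerivAt (fun z : Rn n => (4 * ‖z - y‖ ^ 2) • (z - y)) (0 : Rn n →L[ℝ] Rn n) y := by
  have h1 : HasFDerivAt (fun z : Rn n => 4 * ‖z - y‖ ^ 2) _ y :=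
    (((hasFDerivAt_id y).sub_const y).norm_sq).const_mul 4
  refine (h1.fun_smul ((hasFDerivAt_id y).sub_const y)).congr_fderiv ?_
  simp

theorem ContDiffOn.gradient_sub_norm_sub_pow_four {n : ℕ} {U : Set (Rn n)} (hU : IsOpen U)
    {φ : Rn n → ℝ} (hφ : ContDiffOn ℝ 2 φ U) (y : Rn n) {x : Rn n} (hx : x ∈ U) :
    gradient (fun z => φ z - ‖z - y‖ ^ 4) x = gradient φ x - (4 * ‖x - y‖ ^ 2) • (x - y) := by
  have h1 := ((hφ.differentiableOn (by norm_num)).differentiableAt (hU.mem_nhds hx)).hasGradientAt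
  have h2 := hasGradientAt_norm_sub_pow_four y x
  rw [hasGradientAt_iff_hasFDerivAt] at h1 h2
  have h3 : HasGradientAt (fun z => φ z - ‖z - y‖ ^ 4)
      (gradient φ x - (4 * ‖x - y‖ ^ 2) • (x - y)) x := by
    rw [hasGradientAt_iff_hasFDerivAt, map_sub]
    exact h1.sub h2
  exact h3.gradient

/-- Subtracting a fourth power of the distance to `y` does not change the `p`-Laplacian at `y`. -/
theorem pLaplacian_sub_norm_sub_pow_four {n : ℕ} (p : ℝ) {U : Set (Rn n)} (hU : IsOpen U)
    {φ : Rn n → ℝ} (hφ : ContDiffOn ℝ 2 φ U) {y : Rn n} (hy : y ∈ U) (h0 : gradient φ y ≠ 0) :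
    pLaplacian p (fun z => φ z - ‖z - y‖ ^ 4) y = pLaplacian p φ y := by
  have h1 : HasFDerivAt (gradient φ) (fderiv ℝ (gradient φ) y) y :=
    (((contDiffOn_gradient hU hφ).differentiableOn one_ne_zero).differentiableAt
      (hU.mem_nhds hy)).hasFDerivAt
  have he : gradient (fun z => φ z - ‖z - y‖ ^ 4) =ᶠ[𝓝 y]
      fun x => gradient φ x - (4 * ‖x - y‖ ^ 2) • (x - y) := by
    filter_upwards [hU.mem_nhds hy] with x hx
    exact hφ.gradient_sub_norm_sub_pow_four hU y hx
  have h2 : HasFDerivAt (gradient (fun z => φ z - ‖z - y‖ ^ 4)) (fderiv ℝ (gradient φ) y) y := by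
    have := (h1.sub (hasFDerivAt_gradient_norm_sub_pow_four y)).congr_of_eventuallyEq he
    rwa [sub_zero] at this
  have hg : gradient (fun z => φ z - ‖z - y‖ ^ 4) y = gradient φ y := by
    rw [he.eq_of_nhds]
    simp
  have hV : HasFDerivAt (pFlux p) (fderiv ℝ (pFlux p) (gradient φ y)) (gradient φ y) :=
    ((contDiffAt_pFlux p h0 (k := 1)).differentiableAt one_ne_zero).hasFDerivAt
  have h3 : HasFDerivAt (fun x => pFlux p (gradient φ x)) _ y := hV.comp y h1
  have h4 : HasFDerivAt (fun x => pFlux p (gradient (fun z => φ z - ‖z - y‖ ^ 4) x)) _ y :=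
    HasFDerivAt.comp (g := pFlux p) y (by rwa [hg]) h2
  simp only [pLaplacian, divergence, h3.fderiv, h4.fderiv]

theorem continuousAt_pLaplacian {n : ℕ} (p : ℝ) {U : Set (Rn n)} (hU : IsOpen U)
    {φ : Rn n → ℝ} (hφ : ContDiffOn ℝ 2 φ U) {y : Rn n} (hy : y ∈ U) (h0 : gradient φ y ≠ 0) :
    ContinuousAt (pLaplacian p φ) y := by
  have hgc : ContinuousOn (gradient φ) U := (contDiffOn_gradient hU hφ).continuousOn
  set W := U ∩ gradient φ ⁻¹' {0}ᶜ
  have hW : IsOpen W := hgc.isOpen_inter_preimage hU isOpen_compl_singleton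
  have h1 := (hφ.mono Set.inter_subset_left).pFlux_gradient p hW fun x hx => hx.2
  have h2 := (h1.continuousOn_fderiv_of_isOpen hW le_rfl).continuousAt
    (hW.mem_nhds (show y ∈ W from ⟨hy, h0⟩))
  have h3 : ContinuousAt (fun x => ∑ i : Fin n, EuclideanSpace.proj (𝕜 := ℝ) i
      (fderiv ℝ (fun z => pFlux p (gradient φ z)) x (EuclideanSpace.single i 1))) y :=
    tendsto_finsetSum _ fun i _ => (EuclideanSpace.proj (𝕜 := ℝ) i).continuous.continuousAt.comp
      (h2.clm_apply continuousAt_const)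
  exact h3

/-! ### Weak supersolutions are viscosity supersolutions -/

theorem theorem1p3 {n : ℕ} (hn : 1 ≤ n) (p : ℝ) (hp : 1 < p)
    (Ω : Opens (Rn n)) (hΩ : (Ω : Set (Rn n)).Nonempty)
    (hΩb : Bornology.IsBounded (Ω : Set (Rn n)))
    (f : Rn n → ℝ → ℝ)
    (hf : ContinuousOn (fun z : Rn n × ℝ => f z.1 z.2) ((Ω : Set (Rn n)) ×ˢ Set.univ))
    (hf_anti : ∀ x ∈ Ω, Antitone (f x))
    (u : Rn n → ℝ) (hu : ContinuousOn u (Ω : Set (Rn n)))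
    (hweak : IsWeakSupersolution p Ω (fun x s _ => f x s) u) :
    IsViscositySupersolution p Ω (fun x s _ => f x s) (fun x => (u x : EReal)) := by
  refine ⟨(continuous_coe_real_ereal.comp_continuousOn hu).lowerSemicontinuousOn,
    fun x _ => EReal.coe_ne_bot _, ?_, ?_⟩
  · obtain ⟨x, hx⟩ := hΩ
    exact ⟨x, hx, EReal.coe_ne_top _⟩
  intro x₀ hx₀ φ hφ hφx₀ hφu
  obtain ⟨G, hG, hsuper⟩ := hweak
  rw [EReal.coe_eq_coe_iff] at hφx₀
  rw [EReal.toReal_coe]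
  by_contra! hlim
  obtain ⟨C, hlC, hCf⟩ := EReal.lt_iff_exists_real_btwn.1 hlim
  rw [EReal.coe_lt_coe_iff] at hCf
  obtain ⟨C', hCC', hC'f⟩ := exists_between hCf
  have hΩo : IsOpen (Ω : Set (Rn n)) := Ω.isOpen
  have hgc : ContinuousOn (fun x => f x (u x)) (Ω : Set (Rn n)) :=
    hf.comp (f := fun x => (x, u x)) (continuousOn_id.prodMk hu) fun x hx => ⟨hx, trivial⟩
  have hev : ∀ᶠ x in 𝓝 x₀, x ∈ Ω ∧ C' < f x (u x) ∧ (x ≠ x₀ → -pLaplacian p φ x < C) := by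
    refine (hΩo.eventually_mem hx₀).and
      (((hgc.continuousAt (hΩo.mem_nhds hx₀)).eventually (lt_mem_nhds hC'f)).and ?_)
    have h := eventually_lt_of_limsup_lt hlC
    rw [eventually_nhdsWithin_iff] at h
    filter_upwards [h] with x hx hne
    exact EReal.coe_lt_coe_iff.1 (hx hne)
  obtain ⟨r, hr, hball⟩ := Metric.eventually_nhds_iff_ball.1 hev
  have hBΩ : Metric.ball x₀ r ⊆ (Ω : Set (Rn n)) := fun x hx => (hball x hx).1
  have hstrict : ∀ x ∈ Metric.ball x₀ r, x ≠ x₀ → φ x < u x := by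
    intro y hy hyx
    refine lt_of_le_of_ne (EReal.coe_le_coe_iff.1 (hφu y (hBΩ hy) hyx).1) fun heq => ?_
    -- At a second contact point `y` the gradient of `φ` is nonzero by admissibility. Hence `Δ_p φ'`
    -- is continuous near `y`, the bound by `C` persists there, and the comparison applies around
    -- `y`.
    set φ' : Rn n → ℝ := fun z => φ z - ‖z - y‖ ^ 4 with hφ'
    have hφ'2 : ContDiffOn ℝ 2 φ' (Ω : Set (Rn n)) := by
      have : ContDiff ℝ 2 (fun z : Rn n => (‖z - y‖ ^ 2) ^ 2) :=
        ((contDiff_id.sub contDiff_const).norm_sq ℝ).pow 2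
      refine hφ.sub (this.contDiffOn.congr fun z _ => ?_)
      ring
    have hgy : gradient φ y ≠ 0 := (hφu y (hBΩ hy) hyx).2
    have hg'y : gradient φ' y ≠ 0 := by
      rw [hφ', hφ.gradient_sub_norm_sub_pow_four hΩo y (hBΩ hy)]
      simpa using hgy
    have hlap : -pLaplacian p φ' y < C := by
      rw [hφ', pLaplacian_sub_norm_sub_pow_four p hΩo hφ (hBΩ hy) hgy]
      exact (hball y hy).2.2 hyx
    have hev' : ∀ᶠ x in 𝓝 y, x ∈ Metric.ball x₀ r ∧ x ≠ x₀ ∧ gradient φ' x ≠ 0 ∧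
        -pLaplacian p φ' x < C :=
      (Metric.isOpen_ball.eventually_mem hy).and ((isOpen_ne.eventually_mem hyx).and
        (((((contDiffOn_gradient hΩo hφ'2).continuousOn.continuousAt
          (hΩo.mem_nhds (hBΩ hy))).eventually_ne hg'y)).and
        ((continuousAt_pLaplacian p hΩo hφ'2 (hBΩ hy) hg'y).neg.eventually (gt_mem_nhds hlap))))
    obtain ⟨r', hr', hball'⟩ := Metric.eventually_nhds_iff_ball.1 hev'
    have hB' : Metric.ball y r' ⊆ (Ω : Set (Rn n)) := fun x hx => hBΩ (hball' x hx).1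
    refine hG.not_touching_of_neg_pLaplacian_lt hn hp hu hsuper hr' hB' (hφ'2.mono hB')
      (fun x hx _ => (hball' x hx).2.2.1) hCC' (fun x hx _ => (hball' x hx).2.2.2.le)
      (fun x hx => (hball x (hball' x hx).1).2.1.le) (fun x hx hxy => ?_) (by simp [hφ', heq])
    have h1 := EReal.coe_le_coe_iff.1 (hφu x (hB' hx) (hball' x hx).2.1).1
    have h2 : 0 < ‖x - y‖ ^ 4 := pow_pos (norm_pos_iff.2 (sub_ne_zero.2 hxy)) 4
    simp only [hφ']
    linarith
  exact hG.not_touching_of_neg_pLaplacian_lt hn hp hu hsuper hr hBΩ (hφ.mono hBΩ)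
    (fun x hx hne => (hφu x (hBΩ hx) hne).2) hCC' (fun x hx hne => ((hball x hx).2.2 hne).le)
    (fun x hx => (hball x hx).2.1.le) hstrict hφx₀
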